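/- Let $\Gamma$ be a countable discrete amenable group, $V$ a finite-dimensional real normed vector space, and $p,q\in[1,\infty]$. For a topological space $X$ with a pseudo-distance $\delta$ and $\varepsilon>0$, let $\mathrm{wdim}_\varepsilon(X,\delta)$ be the least $k$ for which there is a continuous map from $X$ to a polyhedron (a locally finite simplicial complex in some $\mathbb R^N$) of dimension at most $k$ all of whose fibres have $\delta$-diameter at most $\varepsilon$ ($\infty$ if there is none). Let $\Gamma$ act on maps $x:\Gamma\to V$ by $(\gamma x)(\cdot)=x(\gamma^{-1}\,\cdot)$, put $ev(x,x')=\|x(e)-x'(e)\|$ with $e$ the neutral element, and for finite $\Omega\subset\Gamma$ put $$ev_{\ell^p(\Omega)}(x,x')=\Big(\sum_{\gamma\in\Omega}ev(\gamma x,\gamma x')^p\Big)^{1/p}\ (p<\infty),\qquad ev_{\ell^\infty(\Omega)}(x,x')=\sup_{\gamma\in\Omega}ev(\gamma x,\gamma x').$$ For $Y\subset V^\Gamma$ and $r\ge 0$ let $B^{Y,p}_r$ be the intersection of $Y$ with the closed ball of radius $r$ about $0$ in $\ell^p(\Gamma;V)$, with the topology induced by the product topology of $V^\Gamma$. For a Følner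 sequence $\{\Omega_i\}$ of $\Gamma$ (left or right) set $$\dim_{\ell^p}(Y,\{\Omega_i\})=\sup_{r\ge0}\ \lim_{\varepsilon\to0^+}\ \limsup_{i\to\infty}\frac{\mathrm{wdim}_\varepsilon(B^{Y,p}_r,ev_{\ell^p(\Omega_i)})}{|\Omega_i|}\in[0,\infty].$$ Let $Y'=\ell^q(\Gamma;V)$. Then: (1) For every finite $\Omega\subset\Gamma$ and every $\varepsilon>0$, $\mathrm{wdim}_\varepsilon(B^{Y',p}_1,ev_{\ell^p(\Omega)})$ equals $\mathrm{wdim}_\varepsilon$ of the closed unit ball of $\ell^p(\Omega;V)$ with its norm distance and norm topology; and if $\varepsilon<1$ this number equals $|\Omega|\dim V$. (2) For every Følner sequence $\{\Omega_i\}$ of $\Gamma$, $\dim_{\ell^p}(\ell^q(\Gamma;V),\{\Omega_i\})=\dim V$. In particular (case $q=p$) $\dim_{\ell^p}\ell^p(\Gamma;V)=\dim V$. -/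

import Mathlib

open Filter Topology MeasureTheory
open scoped ENNReal NNReal

noncomputable section

namespace LpDim

/-- `P` is a polyhedron of dimension at most `k`: the underlying space, with the topology of the
ambient Euclidean space, of a locally finite geometric simplicial complex all of whose simplices
have dimension at most `k` (i.e. at most `k + 1` vertices). -/
def IsPolyhedronOfDimLE {N : ℕ} (k : ℕ) (P : Set (EuclideanSpace ℝ (Fin N))) : Prop :=
  ∃ K : Geometry.SimplicialComplex ℝ (EuclideanSpace ℝ (Fin N)),
    K.space = P ∧
    (∀ s ∈ K.faces, s.card ≤ k + 1) ∧
    (∀ x ∈ K.space, ∃ U ∈ 𝓝 x,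
      {s | s ∈ K.faces ∧ (convexHull ℝ (s : Set (EuclideanSpace ℝ (Fin N))) ∩ U).Nonempty}.Finite)

/-- There is a continuous map (for the topology of `X`) from `X` to a polyhedron of dimension at
most `k`, all of whose fibres have `δ`-diameter at most `ε`. -/
def HasWidthMap (X : Type*) [TopologicalSpace X] (δ : X → X → ℝ) (ε : ℝ) (k : ℕ) : Prop :=
  ∃ (N : ℕ) (P : Set (EuclideanSpace ℝ (Fin N))) (f : X → EuclideanSpace ℝ (Fin N)),
    IsPolyhedronOfDimLE k P ∧ Continuous f ∧ (∀ x, f x ∈ P) ∧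
    ∀ x x', f x = f x' → δ x x' ≤ ε

/-- `wdim_ε (X, τ, δ)`: the least dimension of a polyhedron receiving a continuous map from `X`
whose fibres have `δ`-diameter at most `ε` (it is `⊤` if there is none). -/
def wdim (X : Type*) [TopologicalSpace X] (δ : X → X → ℝ) (ε : ℝ) : ℕ∞ :=
  ⨅ (k : ℕ) (_ : HasWidthMap X δ ε k), (k : ℕ∞)

theorem wdim_antitone (X : Type*) [TopologicalSpace X] (δ : X → X → ℝ) :
    Antitone (wdim X δ) := by
  intro ε ε' h
  refine le_iInf₂ fun k hk => iInf₂_le k ?_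
  obtain ⟨N, P, f, hP, hf, hfP, hd⟩ := hk
  exact ⟨N, P, f, hP, hf, hfP, fun x x' hx => (hd x x' hx).trans h⟩

/-- The pseudo-distance `δ_{ℓ^p(Ω)}` obtained from `δ` and an action of `Γ`. -/
def orbitDist {Γ E : Type*} [SMul Γ E] (δ : E → E → ℝ) (p : ℝ≥0∞) (Ω : Finset Γ) (x x' : E) : ℝ :=
  if p = ∞ then ⨆ γ : Ω, δ ((γ : Γ) • x) ((γ : Γ) • x')
  else (∑ γ ∈ Ω, δ (γ • x) (γ • x') ^ p.toReal) ^ (1 / p.toReal)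

/-- `limsup_i wdim_ε (X, τ, δ_{ℓ^p(Ω_i)}) / |Ω_i|`, for a subset `X` of a space `E` on which `Γ`
acts; the topology of `X` is induced by that of `E`. -/
def widthRate {Γ E : Type*} [SMul Γ E] [TopologicalSpace E] (X : Set E) (δ : E → E → ℝ)
    (p : ℝ≥0∞) (Ω : ℕ → Finset Γ) (ε : ℝ) : ℝ≥0∞ :=
  limsup (fun i => (wdim X (fun x x' => orbitDist δ p (Ω i) (x : E) (x' : E)) ε : ℝ≥0∞) /
    ((Ω i).card : ℝ≥0∞)) atTop

/-- The `ℓ^p(Γ)` width growth coefficient: the limit of `widthRate` as `ε` decreases to `0`. The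
limit exists, see `tendsto_wgc`. -/
def wgc {Γ E : Type*} [SMul Γ E] [TopologicalSpace E] (X : Set E) (δ : E → E → ℝ)
    (p : ℝ≥0∞) (Ω : ℕ → Finset Γ) : ℝ≥0∞ :=
  limUnder (𝓝[>] (0 : ℝ)) (widthRate X δ p Ω)

theorem widthRate_antitone {Γ E : Type*} [SMul Γ E] [TopologicalSpace E] (X : Set E)
    (δ : E → E → ℝ) (p : ℝ≥0∞) (Ω : ℕ → Finset Γ) : Antitone (widthRate X δ p Ω) := by
  intro ε ε' h
  refine limsup_le_limsup (Eventually.of_forall fun i => ?_)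
  exact ENNReal.div_le_div_right (ENat.toENNReal_le.2 (wdim_antitone _ _ h)) _

theorem tendsto_wgc {Γ E : Type*} [SMul Γ E] [TopologicalSpace E] (X : Set E)
    (δ : E → E → ℝ) (p : ℝ≥0∞) (Ω : ℕ → Finset Γ) :
    Tendsto (widthRate X δ p Ω) (𝓝[>] (0 : ℝ)) (𝓝 (wgc X δ p Ω)) :=
  tendsto_nhds_limUnder
    ⟨_, ((widthRate_antitone X δ p Ω).antitoneOn _).tendsto_nhdsGT
      (OrderTop.bddAbove _)⟩

section Sequences

variable {Γ V : Type*} [Group Γ] [NormedAddCommGroup V]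

/-- The natural action of `Γ` on maps `Γ → V`: `(γ • f) x = f (γ⁻¹ * x)`. -/
abbrev translation : MulAction Γ (Γ → V) := arrowAction

/-- Evaluation at the neutral element as a pseudo-distance. -/
def ev (x x' : Γ → V) : ℝ := ‖x 1 - x' 1‖

/-- The pseudo-distance `ev_{ℓ^p(Ω)}` on maps `Γ → V`. -/
def evDist (p : ℝ≥0∞) (Ω : Finset Γ) (x x' : Γ → V) : ℝ :=
  letI : MulAction Γ (Γ → V) := translation
  orbitDist ev p Ω x x'

/-- `ℓ^q(Γ; V)` as a set of maps `Γ → V`. -/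
def ell (Γ V : Type*) [NormedAddCommGroup V] (q : ℝ≥0∞) : Set (Γ → V) :=
  {f | Memℓp f q}

/-- `B^{Y,p}_r`: the intersection of `Y` with the closed ball of radius `r` about `0` in
`ℓ^p(Γ; V)`. As a subset of `Γ → V` it carries the product topology. -/
def ballIn (Y : Set (Γ → V)) (p : ℝ≥0∞) (r : ℝ≥0) : Set (Γ → V) :=
  Y ∩ {f | ∃ g : lp (fun _ : Γ => V) p, ‖g‖ ≤ r ∧ (g : Γ → V) = f}

/-- `dim_{ℓ^p} (Y, {Ω_i})`, the `ℓ^p` von Neumann dimension. -/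
def dimLp (p : ℝ≥0∞) (Y : Set (Γ → V)) (Ω : ℕ → Finset Γ) : ℝ≥0∞ :=
  letI : MulAction Γ (Γ → V) := translation
  ⨆ r : ℝ≥0, wgc (ballIn Y p r) ev p Ω

/-- `Ω` is a Følner sequence of finite sets in the discrete group `Γ`, for the action of `Γ` on
itself by left multiplication or for the one by right multiplication. -/
def IsFolnerSeq (Ω : ℕ → Finset Γ) : Prop :=
  letI : MeasurableSpace Γ := ⊤
  IsFoelner Γ (Measure.count : Measure Γ) atTop (fun i => (Ω i : Set Γ)) ∨
    IsFoelner Γᵐᵒᵖ (Measure.count : Measure Γ) atTop (fun i => (Ω i : Set Γ))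

end Sequences

end LpDim

end

namespace LpDim

/-! Since `(γ • x) 1 = x γ⁻¹`, the pseudo-distance over `Ω` sees only the values of `x` on `Ω⁻¹`.
Restriction to `Ω⁻¹` and extension by zero are continuous, preserve the distances, and exchange the
two unit balls, so everything reduces to the unit ball of a normed space `W` of dimension `n` and to
`ε < 1`.

A linear embedding into an `n`-simplex gives width at most `n`. Conversely, let `f` map the ball to
a polyhedron `P` of dimension at most `k` with fibres of diameter at most `ε < 1`. A partition of
unity yields a C¹ map `g` such that `g ∘ f` moves every point by less than `1`, by compactness by at
most some `η < 1`. A Brouwer-type argument (`ball_subset_image_closedBall`) shows that `g '' P`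
contains a ball. As C¹ maps do not raise Hausdorff dimension, `n ≤ dimH P ≤ k`.

The Brouwer-type input is that `id + u` is onto for `u` continuous with compact support. It is
proved analytically, by a change of variables that is polynomial in a deformation parameter. -/

/-! ### Analytic proof that compactly supported C¹ perturbations of the identity are onto -/

theorem integral_eq_of_polynomial_of_infinite {X : Type*} [MeasurableSpace X] {ν : Measure X}
    {F : ℝ → X → ℝ} {D : ℕ}
    (hF : ∀ x, ∃ P : Polynomial ℝ, P.natDegree ≤ D ∧ ∀ t, F t x = P.eval t)
    (hint : ∀ t, Integrable (F t) ν) {T : Set ℝ} (hT : T.Infinite) {J : ℝ}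
    (hJ : ∀ t ∈ T, ∫ x, F t x ∂ν = J) (t : ℝ) : ∫ x, F t x ∂ν = J := by
  obtain ⟨s, hsT, hs⟩ := hT.exists_subset_card_eq (D + 1)
  have hne : s.Nonempty := Finset.card_pos.1 (by omega)
  have hinj : Set.InjOn (id : ℝ → ℝ) s := Function.injective_id.injOn
  -- Interpolating at `D + 1` nodes of `T` uses weights independent of `x`, so it commutes with the
  -- integral; the weights sum to `1`.
  have key : ∀ x, F t x = ∑ i ∈ s, F i x * (Lagrange.basis s id i).eval t := by
    intro x
    obtain ⟨P, hPD, hP⟩ := hF x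
    have hdeg : P.degree < (s.card : WithBot ℕ) := by
      rw [hs]
      exact lt_of_le_of_lt P.degree_le_natDegree (by exact_mod_cast Nat.lt_succ_of_le hPD)
    rw [hP t]
    conv_lhs => rw [Lagrange.eq_interpolate hinj hdeg]
    rw [Lagrange.interpolate_apply, Polynomial.eval_finsetSum]
    simp [hP]
  simp_rw [key]
  rw [integral_finsetSum _ fun i _ => (hint i).mul_const _]
  simp_rw [integral_mul_const]
  rw [Finset.sum_congr rfl fun i hi => by rw [hJ i (hsT hi)], ← Finset.mul_sum,
    ← Polynomial.eval_finsetSum, Lagrange.sum_basis hinj hne]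
  simp

section Euclidean

variable {E : Type*} [NormedAddCommGroup E] [InnerProductSpace ℝ E] [FiniteDimensional ℝ E]

theorem exists_polynomial_det_one_add_smul (A : E →L[ℝ] E) :
    ∃ P : Polynomial ℝ, P.natDegree ≤ Module.finrank ℝ E ∧
      ∀ t : ℝ, (ContinuousLinearMap.id ℝ E + t • A).det = P.eval t := by
  let b := Module.finBasis ℝ E
  let M := LinearMap.toMatrix b b (A : E →ₗ[ℝ] E)
  refine ⟨Matrix.det ((Polynomial.X : Polynomial ℝ) • M.map Polynomial.C +
    (1 : Matrix _ _ ℝ).map Polynomial.C), ?_, fun t => ?_⟩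
  · simpa using Polynomial.natDegree_det_X_add_C_le M 1
  · rw [ContinuousLinearMap.det, ← LinearMap.det_toMatrix b, ← Polynomial.coe_evalRingHom,
      RingHom.map_det]
    congr 1
    ext i j
    by_cases hij : i = j <;>
      simp [M, LinearMap.toMatrix_apply, hij, add_comm, mul_comm t]

omit [FiniteDimensional ℝ E] in
theorem exists_polynomial_sub_norm_sq (M : ℝ) (a b : E) :
    ∃ P : Polynomial ℝ, P.natDegree ≤ 2 ∧ ∀ t : ℝ, M - ‖a + t • b‖ ^ 2 = P.eval t := by
  refine ⟨Polynomial.C (-‖b‖ ^ 2) * Polynomial.X ^ 2 +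
    Polynomial.C (-(2 * inner ℝ a b)) * Polynomial.X + Polynomial.C (M - ‖a‖ ^ 2),
    Polynomial.natDegree_quadratic_le, fun t => ?_⟩
  rw [norm_add_sq_real, norm_smul, inner_smul_right]
  simp only [Polynomial.eval_add, Polynomial.eval_mul, Polynomial.eval_C, Polynomial.eval_pow,
    Polynomial.eval_X, mul_pow, Real.norm_eq_abs, sq_abs]
  ring

theorem bijective_id_add_of_lipschitzWith {u : E → E} {K : ℝ≥0} (hu : LipschitzWith K u)
    (hK : K < 1) : Function.Bijective fun x => x + u x := by
  have h : ApproximatesLinearOn (fun x => x + u x) (ContinuousLinearEquiv.refl ℝ E : E →L[ℝ] E)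
      Set.univ K := by
    intro x _ y _
    have := hu.dist_le_mul x y
    rw [dist_eq_norm, dist_eq_norm] at this
    rwa [show x + u x - (y + u y) - (ContinuousLinearEquiv.refl ℝ E : E →L[ℝ] E) (x - y) =
      u x - u y by simp; abel]
  have hc : Subsingleton E ∨
      K < ‖((ContinuousLinearEquiv.refl ℝ E).symm : E →L[ℝ] E)‖₊⁻¹ := by
    rcases subsingleton_or_nontrivial E with h | h
    · exact Or.inl h
    · right
      have : ‖((ContinuousLinearEquiv.refl ℝ E).symm : E →L[ℝ] E)‖₊ = 1 := by
        ext
        exact ContinuousLinearMap.norm_id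
      rwa [this, inv_one]
  exact ⟨Set.injOn_univ.1 (h.injOn hc), h.surjective hc⟩

variable [MeasurableSpace E] [BorelSpace E]

/-- For small `t`, `x ↦ x + t • u x` is a bijection of `S` with positive Jacobian, so the change of
variables holds with `t • u` in place of `u`. The integrand is polynomial in `t`, so the identity
persists to `t = 1`, where injectivity may fail. -/
theorem setIntegral_comp_id_add_mul_det (μ : Measure E) [μ.IsAddHaarMeasure] {u : E → E}
    (hu : ContDiff ℝ 1 u) {S : Set E} (hS : IsCompact S) (hSu : ∀ x ∉ S, u x = 0)
    {ρ : E → ℝ} {D : ℕ} (hρ : Continuous ρ)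
    (hρD : ∀ a b, ∃ P : Polynomial ℝ, P.natDegree ≤ D ∧ ∀ t : ℝ, ρ (a + t • b) = P.eval t) :
    ∫ x in S, (ContinuousLinearMap.id ℝ E + fderiv ℝ u x).det * ρ (x + u x) ∂μ =
      ∫ x in S, ρ x ∂μ := by
  obtain ⟨K, hK⟩ := hu.lipschitzWith_of_hasCompactSupport (HasCompactSupport.intro hS hSu)
    one_ne_zero
  have hdu : Continuous (fderiv ℝ u) := hu.continuous_fderiv one_ne_zero
  have hdet : Continuous fun z : ℝ × E =>
      (ContinuousLinearMap.id ℝ E + z.1 • fderiv ℝ u z.2).det :=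
    ContinuousLinearMap.continuous_det.comp (by fun_prop)
  let F : ℝ → E → ℝ := fun t x =>
    (ContinuousLinearMap.id ℝ E + t • fderiv ℝ u x).det * ρ (x + t • u x)
  have hFc : ∀ t, Continuous (F t) := fun t =>
    (hdet.comp (by fun_prop : Continuous fun x : E => (t, x))).mul
      (hρ.comp (continuous_id.add (continuous_const.smul hu.continuous)))
  have hpos : ∀ᶠ t : ℝ in 𝓝 0, ∀ x ∈ S,
      0 < (ContinuousLinearMap.id ℝ E + t • fderiv ℝ u x).det := by
    refine hS.eventually_forall_of_forall_eventually fun x _ => ?_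
    have := hdet.tendsto ((0 : ℝ), x)
    rw [show (ContinuousLinearMap.id ℝ E + (0 : ℝ) • fderiv ℝ u x).det = 1 by
      simp [ContinuousLinearMap.det]] at this
    exact this.eventually (lt_mem_nhds one_pos)
  have hsmall : ∀ᶠ t : ℝ in 𝓝 0, ‖t‖₊ * K < 1 := by
    have : Tendsto (fun t : ℝ => ‖t‖₊ * K) (𝓝 0) (𝓝 (‖(0 : ℝ)‖₊ * K)) :=
      (by fun_prop : Continuous fun t : ℝ => ‖t‖₊ * K).tendsto 0
    rw [nnnorm_zero, zero_mul] at this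
    exact this.eventually (gt_mem_nhds one_pos)
  have hinf : {t : ℝ | (∀ x ∈ S, 0 < (ContinuousLinearMap.id ℝ E + t • fderiv ℝ u x).det) ∧
      ‖t‖₊ * K < 1}.Infinite :=
    infinite_of_mem_nhds 0 (hpos.and hsmall)
  have main := integral_eq_of_polynomial_of_infinite (ν := μ.restrict S) (F := F)
    (D := Module.finrank ℝ E + D) (fun x => ?_)
    (fun t => (hFc t).continuousOn.integrableOn_compact hS) hinf (J := ∫ x in S, ρ x ∂μ) ?_ 1
  · simpa [F] using main
  · obtain ⟨P, hP, hP'⟩ := exists_polynomial_det_one_add_smul (fderiv ℝ u x)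
    obtain ⟨Q, hQ, hQ'⟩ := hρD x (u x)
    exact ⟨P * Q, Polynomial.natDegree_mul_le.trans (add_le_add hP hQ), fun t => by
      simp [F, hP', hQ']⟩
  · rintro t ⟨ht, htK⟩
    have hlip : LipschitzWith (‖t‖₊ * K) fun x => t • u x := (lipschitzWith_smul t).comp hK
    obtain ⟨hinj, hsurj⟩ := bijective_id_add_of_lipschitzWith hlip htK
    -- Points outside `S` are fixed, so by injectivity no point of `S` can land there.
    have himg : (fun x => x + t • u x) '' S = S := by
      refine Set.Subset.antisymm ?_ fun y hy => ?_
      · rintro _ ⟨x, hx, rfl⟩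
        by_contra hxS
        have hfix : x + t • u x = x := hinj (by simp [hSu _ hxS])
        refine hxS ?_
        change x + t • u x ∈ S
        rwa [hfix]
      · obtain ⟨x, rfl⟩ := hsurj y
        refine ⟨x, ?_, rfl⟩
        by_contra hx
        simp only [hSu x hx, smul_zero, add_zero] at hy
        exact hx hy
    have hder : ∀ x ∈ S, HasFDerivWithinAt (fun x => x + t • u x)
        (ContinuousLinearMap.id ℝ E + t • fderiv ℝ u x) S x := fun x _ =>
      ((hasFDerivAt_id x).add
        (((hu.differentiable one_ne_zero) x).hasFDerivAt.const_smul t)).hasFDerivWithinAt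
    have := integral_image_eq_integral_abs_det_fderiv_smul μ hS.measurableSet hder hinj.injOn ρ
    rw [himg] at this
    rw [this]
    refine setIntegral_congr_fun hS.measurableSet fun x hx => ?_
    simp [F, abs_of_pos (ht x hx)]

/-- If `c` is missed by a distance `δ`, test the integral identity on powers of `M - ‖y - c‖ ^ 2`.
One side is at least a multiple of `(M - δ ^ 2 / 4) ^ k`, from the mass near `c`; the other is at
most a multiple of `(M - δ ^ 2) ^ k`. Large `k` gives a contradiction. -/
theorem surjective_id_add_of_contDiff (μ : Measure E) [μ.IsAddHaarMeasure] {u : E → E}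
    (hu : ContDiff ℝ 1 u) (hs : HasCompactSupport u) : Function.Surjective fun x => x + u x := by
  intro c
  by_contra! hc
  obtain ⟨R₀, hR₀⟩ := hs.isCompact.isBounded.subset_closedBall c
  set R := max R₀ 1
  have hR : 0 < R := lt_max_of_lt_right one_pos
  have hS : IsCompact (Metric.closedBall c R) := isCompact_closedBall c R
  have hSu : ∀ x ∉ Metric.closedBall c R, u x = 0 := fun x hx => by
    by_contra h
    exact hx (Metric.closedBall_subset_closedBall (le_max_left _ _)
      (hR₀ (subset_tsupport u h)))
  have hcont : Continuous fun x => ‖x + u x - c‖ :=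
    ((continuous_id.add hu.continuous).sub continuous_const).norm
  obtain ⟨x₀, hx₀, hmin⟩ := hS.exists_isMinOn ⟨c, Metric.mem_closedBall_self hR.le⟩
    hcont.continuousOn
  obtain ⟨C, hC⟩ := hS.exists_bound_of_continuousOn hcont.continuousOn
  set δ := ‖x₀ + u x₀ - c‖
  have hδ : 0 < δ := norm_pos_iff.2 (sub_ne_zero.2 (hc x₀))
  have hδC : δ ≤ C := by simpa [δ] using hC x₀ hx₀
  -- Large enough that `M - ‖y - c‖ ^ 2` is nonnegative both on the ball and on its image.
  set M := R ^ 2 + C ^ 2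
  have hMδ : δ ^ 2 ≤ M := by nlinarith
  set b := min (δ / 2) R
  have hb : 0 < b := lt_min (by positivity) hR
  have hdet : Continuous fun x => (ContinuousLinearMap.id ℝ E + fderiv ℝ u x).det :=
    ContinuousLinearMap.continuous_det.comp
      (continuous_const.add (hu.continuous_fderiv one_ne_zero))
  set m := μ.real (Metric.closedBall c b)
  have hm : 0 < m := ENNReal.toReal_pos (Metric.measure_closedBall_pos μ c hb).ne'
    (isCompact_closedBall c b).measure_lt_top.ne
  set I := ∫ x in Metric.closedBall c R, |(ContinuousLinearMap.id ℝ E + fderiv ℝ u x).det| ∂μ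
  have hρc : ∀ k : ℕ, Continuous fun y => (M - ‖y - c‖ ^ 2) ^ k := fun k => by fun_prop
  have key : ∀ k : ℕ, m * (M - δ ^ 2 / 4) ^ k ≤ I * (M - δ ^ 2) ^ k := by
    intro k
    calc m * (M - δ ^ 2 / 4) ^ k
        = ∫ x in Metric.closedBall c b, (M - δ ^ 2 / 4) ^ k ∂μ := by
          rw [setIntegral_const, smul_eq_mul]
      _ ≤ ∫ x in Metric.closedBall c b, (M - ‖x - c‖ ^ 2) ^ k ∂μ := by
          refine setIntegral_mono_on (integrableOn_const (isCompact_closedBall c b).measure_lt_top.ne)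
            ((hρc k).continuousOn.integrableOn_compact (isCompact_closedBall c b))
            measurableSet_closedBall fun x hx => ?_
          rw [mem_closedBall_iff_norm] at hx
          have h1 : ‖x - c‖ ≤ δ / 2 := hx.trans (min_le_left _ _)
          have h2 : ‖x - c‖ ^ 2 ≤ (δ / 2) ^ 2 := pow_le_pow_left₀ (norm_nonneg _) h1 2
          exact pow_le_pow_left₀ (by nlinarith) (by nlinarith) k
      _ ≤ ∫ x in Metric.closedBall c R, (M - ‖x - c‖ ^ 2) ^ k ∂μ := by
          refine setIntegral_mono_set ((hρc k).continuousOn.integrableOn_compact hS) ?_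
            (Metric.closedBall_subset_closedBall (min_le_right _ _)).eventuallyLE
          filter_upwards [ae_restrict_mem measurableSet_closedBall] with x hx
          rw [mem_closedBall_iff_norm] at hx
          have h2 : ‖x - c‖ ^ 2 ≤ R ^ 2 := pow_le_pow_left₀ (norm_nonneg _) hx 2
          exact pow_nonneg (by nlinarith [sq_nonneg C]) k
      _ = ∫ x in Metric.closedBall c R, (ContinuousLinearMap.id ℝ E + fderiv ℝ u x).det *
            (M - ‖x + u x - c‖ ^ 2) ^ k ∂μ := by
          refine (setIntegral_comp_id_add_mul_det μ hu hS hSu (D := k * 2) (hρc k)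
            fun a e => ?_).symm
          obtain ⟨P, hP, hP'⟩ := exists_polynomial_sub_norm_sq M (a - c) e
          refine ⟨P ^ k, Polynomial.natDegree_pow_le_of_le k hP, fun t => ?_⟩
          rw [Polynomial.eval_pow, ← hP', add_sub_right_comm a]
      _ ≤ ∫ x in Metric.closedBall c R,
            |(ContinuousLinearMap.id ℝ E + fderiv ℝ u x).det| * (M - δ ^ 2) ^ k ∂μ := by
          refine setIntegral_mono_on
            ((hdet.mul ((hρc k).comp
              (continuous_id.add hu.continuous))).continuousOn.integrableOn_compact hS)
            ((hdet.abs.mul continuous_const).continuousOn.integrableOn_compact hS)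
            measurableSet_closedBall fun x hx => ?_
          have h1 : δ ^ 2 ≤ ‖x + u x - c‖ ^ 2 := pow_le_pow_left₀ hδ.le (hmin hx) 2
          have h2 : ‖x + u x - c‖ ^ 2 ≤ C ^ 2 :=
            pow_le_pow_left₀ (norm_nonneg _) (by simpa using hC x hx) 2
          have h3 : 0 ≤ M - ‖x + u x - c‖ ^ 2 := by nlinarith [sq_nonneg R]
          exact mul_le_mul (le_abs_self _) (pow_le_pow_left₀ h3 (by linarith) k)
            (pow_nonneg h3 k) (abs_nonneg _)
      _ = I * (M - δ ^ 2) ^ k := integral_mul_const _ _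
  have hpos : 0 < M - δ ^ 2 / 4 := by nlinarith
  have hq : ∀ k : ℕ, m ≤ I * ((M - δ ^ 2) / (M - δ ^ 2 / 4)) ^ k := fun k => by
    rw [div_pow, ← mul_div_assoc, le_div_iff₀ (pow_pos hpos k)]
    exact key k
  have hlim : Tendsto (fun k : ℕ => I * ((M - δ ^ 2) / (M - δ ^ 2 / 4)) ^ k) atTop (𝓝 (I * 0)) :=
    (tendsto_pow_atTop_nhds_zero_of_lt_one (div_nonneg (by linarith) hpos.le)
      ((div_lt_one hpos).2 (by nlinarith))).const_mul I
  rw [mul_zero] at hlim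
  exact hm.not_ge (ge_of_tendsto' hlim hq)

end Euclidean

/-! ### Continuous perturbations and the covering of a smaller ball -/

section Normed

variable {W : Type*} [NormedAddCommGroup W] [NormedSpace ℝ W] [FiniteDimensional ℝ W]

theorem surjective_id_add_of_continuous {u : W → W} (hu : Continuous u)
    (hs : HasCompactSupport u) : Function.Surjective fun x => x + u x := by
  let e : W ≃L[ℝ] EuclideanSpace ℝ (Fin (Module.finrank ℝ W)) := toEuclidean
  have hsmooth : ∀ v : W → W, ContDiff ℝ 1 v → HasCompactSupport v →
      Function.Surjective fun x => x + v x := by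
    intro v hv hvs y
    have h1 : ContDiff ℝ 1 fun z => e (v (e.symm z)) :=
      e.contDiff.comp (hv.comp e.symm.contDiff)
    have h2 : HasCompactSupport fun z => e (v (e.symm z)) :=
      (hvs.comp_homeomorph e.symm.toHomeomorph).comp_left (g := e) (map_zero e)
    obtain ⟨z, hz⟩ := surjective_id_add_of_contDiff volume h1 h2 (e y)
    exact ⟨e.symm z, e.injective (by simpa using hz)⟩
  intro c
  by_contra! hc
  obtain ⟨R, hR⟩ := hs.isCompact.isBounded.subset_closedBall 0
  have hcont : Continuous fun x => ‖x + u x - c‖ :=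
    ((continuous_id.add hu).sub continuous_const).norm
  -- Outside the support of `u` the distance to `c` is `‖x - c‖`, which tends to infinity; hence the
  -- minimum is attained, and it is positive. A C¹ approximation of `u` within `δ` then cannot hit
  -- `c`.
  obtain ⟨δ, hδ, hδc⟩ : ∃ δ > 0, ∀ x, δ ≤ ‖x + u x - c‖ := by
    obtain ⟨x₀, hx₀⟩ := hcont.exists_forall_le (by
      have h1 : Tendsto (fun x : W => ‖x - c‖) (cocompact W) atTop :=
        tendsto_norm_cocompact_atTop.comp (Homeomorph.subRight c).isClosedEmbedding.tendsto_cocompact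
      refine h1.congr' ?_
      filter_upwards [hs.isCompact.compl_mem_cocompact] with x hx
      rw [image_eq_zero_of_notMem_tsupport hx, add_zero])
    exact ⟨_, norm_pos_iff.2 (sub_ne_zero.2 (hc x₀)), hx₀⟩
  obtain ⟨g, hg, hgu, hgs⟩ := hu.exists_contDiff_approx 1 (ε := fun _ => δ) continuous_const
    fun _ => hδ
  obtain ⟨x, hx⟩ := hsmooth g hg (hs.mono hgs) c
  have h1 := hδc x
  have h2 := hgu x
  rw [dist_comm, dist_eq_norm] at h2
  rw [← hx, show x + u x - (x + g x) = u x - g x by abel] at h1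
  exact h1.not_gt h2

/-- A continuous map that moves no point of the closed unit ball by more than `η` covers the open
ball of radius `1 - η`. -/
theorem ball_subset_image_closedBall {φ : W → W} {η : ℝ}
    (hφ : ContinuousOn φ (Metric.closedBall 0 1))
    (hη : ∀ x ∈ Metric.closedBall (0 : W) 1, ‖φ x - x‖ ≤ η) :
    Metric.ball 0 (1 - η) ⊆ φ '' Metric.closedBall 0 1 := by
  intro c hc
  rw [mem_ball_zero_iff] at hc
  have hη0 : 0 ≤ η := (norm_nonneg _).trans (hη 0 (by simp))
  -- The radial retraction onto the unit ball and the cutoff `χ` extend the displacement of `φ` to a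
  -- compactly supported `u` still bounded by `η`.
  let r : W → W := fun x => (max 1 ‖x‖)⁻¹ • x
  have hmax : ∀ x : W, 0 < max 1 ‖x‖ := fun x => lt_max_of_lt_left one_pos
  have hr : Continuous r :=
    ((continuous_const.max continuous_norm).inv₀ fun x => (hmax x).ne').smul continuous_id
  have hrb : ∀ x, r x ∈ Metric.closedBall (0 : W) 1 := fun x => by
    rw [mem_closedBall_zero_iff, norm_smul, norm_inv, Real.norm_of_nonneg (hmax x).le,
      inv_mul_le_one₀ (hmax x)]
    exact le_max_right _ _
  have hrid : ∀ x, ‖x‖ ≤ 1 → r x = x := fun x hx => by simp [r, max_eq_left hx]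
  let χ : W → ℝ := fun x => max 0 (min 1 (2 - ‖x‖))
  have hχ0 : ∀ x, 0 ≤ χ x := fun x => le_max_left _ _
  have hχ1 : ∀ x, χ x ≤ 1 := fun x => max_le zero_le_one (min_le_left _ _)
  let u : W → W := fun x => χ x • (φ (r x) - r x)
  have hu : Continuous u :=
    (by fun_prop : Continuous χ).smul ((hφ.comp_continuous hr hrb).sub hr)
  have hus : HasCompactSupport u := by
    refine HasCompactSupport.intro (isCompact_closedBall (0 : W) 2) fun x hx => ?_
    rw [mem_closedBall_zero_iff, not_le] at hx
    have : χ x = 0 := max_eq_left ((min_le_right _ _).trans (by linarith))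
    simp [u, this]
  have hun : ∀ x, ‖u x‖ ≤ η := fun x => by
    rw [norm_smul, Real.norm_of_nonneg (hχ0 x)]
    exact (mul_le_of_le_one_left (norm_nonneg _) (hχ1 x)).trans (hη _ (hrb x))
  obtain ⟨x, hx⟩ := surjective_id_add_of_continuous hu hus c
  -- The solution satisfies `‖x‖ ≤ ‖c‖ + η < 1`, so it lies where `x + u x` is `φ x`.
  have hx1 : ‖x‖ ≤ 1 := by
    have : x = c - u x := by rw [← hx]; simp
    rw [this]
    exact (norm_sub_le _ _).trans (by linarith [hun x])
  refine ⟨x, mem_closedBall_zero_iff.2 hx1, ?_⟩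
  have h1 : χ x = 1 := by
    have : (1 : ℝ) ≤ 2 - ‖x‖ := by linarith
    simp [χ, min_eq_left this]
  simpa [u, h1, hrid x hx1] using hx

end Normed


/-! ### Hausdorff dimension of polyhedra -/

section Polyhedra

theorem isPolyhedronOfDimLE_convexHull {N k : ℕ} {s : Finset (EuclideanSpace ℝ (Fin N))}
    (hs : AffineIndependent ℝ ((↑) : s → EuclideanSpace ℝ (Fin N)))
    (hne : s.Nonempty) (hk : s.card ≤ k + 1) :
    IsPolyhedronOfDimLE k (convexHull ℝ (s : Set (EuclideanSpace ℝ (Fin N)))) := by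
  let K : Geometry.SimplicialComplex ℝ (EuclideanSpace ℝ (Fin N)) :=
    { faces := {t | t ⊆ s ∧ t.Nonempty}
      isRelLowerSet_faces := fun _ ht => ⟨ht.2, fun _ hbt hb => ⟨hbt.trans ht.1, hb⟩⟩
      indep := fun ht => hs.mono ht.1
      inter_subset_convexHull := fun ht ht' => (hs.convexHull_inter ht.1 ht'.1).ge }
  refine ⟨K, Set.Subset.antisymm ?_ ?_, fun t ht => (Finset.card_le_card ht.1).trans hk,
    fun x _ => ⟨Set.univ, univ_mem, (s.powerset.finite_toSet).subset fun t ht => ?_⟩⟩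
  · exact Set.iUnion₂_subset fun t ht => convexHull_mono (Finset.coe_subset.2 ht.1)
  · exact K.convexHull_subset_space (s := s) ⟨Finset.Subset.refl s, hne⟩
  · exact Finset.mem_coe.2 (Finset.mem_powerset.2 ht.1.1)

theorem dimH_convexHull_le {E : Type*} [NormedAddCommGroup E] [NormedSpace ℝ E]
    [FiniteDimensional ℝ E] {s : Finset E} {k : ℕ} (hk : s.card ≤ k + 1) :
    dimH (convexHull ℝ (s : Set E)) ≤ k := by
  classical
  rcases s.eq_empty_or_nonempty with rfl | hs
  · simp
  obtain ⟨m, hm⟩ : ∃ m, s.card = m + 1 := ⟨s.card - 1, by have := hs.card_pos; omega⟩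
  rw [Real.Convex.dimH_eq_finrank_vectorSpan (convex_convexHull ℝ _) (by simpa using hs),
    ← direction_affineSpan, affineSpan_convexHull, direction_affineSpan]
  have := finrank_vectorSpan_image_finset_le ℝ (id : E → E) s hm
  rw [Finset.image_id] at this
  exact_mod_cast this.trans (by omega)

/-- Hausdorff dimension is detected near a single point, and there local finiteness leaves finitely
many simplices. -/
theorem IsPolyhedronOfDimLE.dimH_le {N k : ℕ} {P : Set (EuclideanSpace ℝ (Fin N))}
    (hP : IsPolyhedronOfDimLE k P) : dimH P ≤ k := by
  obtain ⟨K, rfl, hk, hfin⟩ := hP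
  by_contra! h
  obtain ⟨x, hx, hxt⟩ := exists_mem_nhdsWithin_lt_dimH_of_lt_dimH h
  obtain ⟨U, hU, hUfin⟩ := hfin x hx
  refine (hxt (K.space ∩ U) (inter_mem_nhdsWithin _ hU)).not_ge ?_
  refine (dimH_mono (t := ⋃ s ∈ {s | s ∈ K.faces ∧
    (convexHull ℝ (s : Set (EuclideanSpace ℝ (Fin N))) ∩ U).Nonempty},
      convexHull ℝ (s : Set (EuclideanSpace ℝ (Fin N)))) ?_).trans ?_
  · rintro y ⟨hy, hyU⟩
    obtain ⟨s, hs, hys⟩ := K.mem_space_iff.1 hy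
    exact Set.mem_biUnion (x := s) ⟨hs, y, hys, hyU⟩ hys
  · rw [dimH_bUnion hUfin.countable]
    exact iSup₂_le fun s hs => dimH_convexHull_le (hk s hs.1)

end Polyhedra

/-! ### Width of the unit ball of a normed space -/

section Width

variable {W : Type*} [NormedAddCommGroup W] [NormedSpace ℝ W] [FiniteDimensional ℝ W]

theorem finrank_le_of_hasWidthMap {ε : ℝ} (hε : ε < 1) {k : ℕ}
    (h : HasWidthMap (Metric.closedBall (0 : W) 1) (fun x x' => dist x x') ε k) :
    Module.finrank ℝ W ≤ k := by
  obtain ⟨N, P, f, hP, hf, hfP, hd⟩ := h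
  have : CompactSpace (Metric.closedBall (0 : W) 1) :=
    isCompact_iff_compactSpace.1 (isCompact_closedBall _ _)
  obtain ⟨g, hg⟩ := exists_contMDiffMap_forall_mem_convex_of_local_const (n := 1)
    (modelWithCornersSelf ℝ (EuclideanSpace ℝ (Fin N)))
    -- The admissible values at `y` are the points at distance less than `1` from the whole fibre: a
    -- convex set, containing the fibre itself because `ε < 1`. A value admissible at `y` stays so
    -- nearby, because `f` is closed on the compact ball.
    (t := fun y => {c : W | ∀ x, f x = y → dist c (x : W) < 1})
    (fun y => by
      simp only [Set.ofPred_forall]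
      exact convex_iInter₂ fun x _ => convex_ball (x : W) 1)
    (fun y => by
      obtain ⟨c, hc⟩ : ∃ c : W, ∀ x, f x = y → dist c (x : W) < 1 := by
        by_cases hy : ∃ x, f x = y
        · obtain ⟨x, rfl⟩ := hy
          exact ⟨x, fun x' hx' => (hd x x' hx'.symm).trans_lt hε⟩
        · exact ⟨0, fun x hx => (hy ⟨x, hx⟩).elim⟩
      refine ⟨c, ?_⟩
      have hA : IsClosed {x : Metric.closedBall (0 : W) 1 | 1 ≤ dist c (x : W)} :=
        isClosed_le continuous_const (continuous_const.dist continuous_subtype_val)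
      filter_upwards [(hf.isClosedMap _ hA).isOpen_compl.mem_nhds (x := y) (by
        rintro ⟨x, hx, hxy⟩
        exact (hc x hxy).not_ge hx)] with y' hy' x hx
      by_contra! hlt
      exact hy' ⟨x, hlt, hx⟩)
  have hgs : ContDiff ℝ 1 g := g.contMDiff.contDiff
  have hgf : Continuous fun x => g (f x) := hgs.continuous.comp hf
  obtain ⟨x₀, -, hx₀⟩ := isCompact_univ.exists_isMaxOn
    ⟨(⟨0, by simp⟩ : Metric.closedBall (0 : W) 1), Set.mem_univ _⟩
    (hgf.dist continuous_subtype_val).continuousOn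
  have hη : 0 < 1 - dist (g (f x₀)) (x₀ : W) := sub_pos.2 (hg _ x₀ rfl)
  let φ : W → W := Function.extend Subtype.val (fun x => g (f x)) 0
  have hφ : ∀ x : Metric.closedBall (0 : W) 1, φ x = g (f x) := fun x =>
    Subtype.val_injective.extend_apply _ _ x
  have hsub : Metric.ball 0 (1 - dist (g (f x₀)) (x₀ : W)) ⊆ g '' P := by
    refine (ball_subset_image_closedBall (φ := φ) ?_ fun x hx => ?_).trans ?_
    · rw [continuousOn_iff_continuous_domRestrict]
      exact hgf.congr fun x => (hφ x).symm
    · rw [← dist_eq_norm, hφ ⟨x, hx⟩]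
      exact isMaxOn_iff.1 hx₀ ⟨x, hx⟩ (Set.mem_univ _)
    · rintro _ ⟨x, hx, rfl⟩
      exact ⟨f ⟨x, hx⟩, hfP _, (hφ ⟨x, hx⟩).symm⟩
  have : (Module.finrank ℝ W : ℝ≥0∞) ≤ k := calc
    _ = dimH (Metric.ball (0 : W) (1 - dist (g (f x₀)) (x₀ : W))) :=
        (Real.dimH_of_mem_nhds (Metric.ball_mem_nhds 0 hη)).symm
    _ ≤ dimH (g '' P) := dimH_mono hsub
    _ ≤ dimH P := hgs.contDiffOn.dimH_image_le convex_univ (Set.subset_univ P)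
    _ ≤ k := hP.dimH_le
  exact_mod_cast this

theorem exists_continuous_injective_polyhedron (W : Type*) [NormedAddCommGroup W]
    [NormedSpace ℝ W] [FiniteDimensional ℝ W] (r : ℝ) :
    ∃ (N : ℕ) (P : Set (EuclideanSpace ℝ (Fin N))) (f : W → EuclideanSpace ℝ (Fin N)),
      IsPolyhedronOfDimLE (Module.finrank ℝ W) P ∧ Continuous f ∧ Function.Injective f ∧
        ∀ x, ‖x‖ ≤ r → f x ∈ P := by
  classical
  let e : W ≃L[ℝ] EuclideanSpace ℝ (Fin (Module.finrank ℝ W)) := toEuclidean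
  obtain ⟨s, b, hb⟩ := AffineBasis.exists_affineBasis ℝ
    (EuclideanSpace ℝ (Fin (Module.finrank ℝ W))) (EuclideanSpace ℝ (Fin (Module.finrank ℝ W)))
  lift s to Finset (EuclideanSpace ℝ (Fin (Module.finrank ℝ W))) using b.finite_set
  have hcard : s.card = Module.finrank ℝ W + 1 := by
    simpa using b.card_eq_finrank_add_one
  have hint := b.centroid_mem_interior_convexHull
  rw [hb, Subtype.range_coe] at hint
  have hind : AffineIndependent ℝ ((↑) : s → EuclideanSpace ℝ (Fin (Module.finrank ℝ W))) :=
    hb ▸ b.ind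
  set c := Finset.univ.centroid ℝ ((↑) : s → EuclideanSpace ℝ (Fin (Module.finrank ℝ W)))
  obtain ⟨δ, hδ, hδs⟩ := Metric.nhds_basis_closedBall.mem_iff.1 (mem_interior_iff_mem_nhds.1 hint)
  let e' : W →L[ℝ] EuclideanSpace ℝ (Fin (Module.finrank ℝ W)) := e
  set C : ℝ := ‖e'‖ * |r| + 1
  -- The summand `1` in `C` is needed when `‖e'‖ * |r| = 0`.
  have hC : 0 < C := by positivity
  refine ⟨_, _, fun x => c + (δ / C) • e x, isPolyhedronOfDimLE_convexHull hind
    (Finset.card_pos.1 (by omega)) hcard.le, by fun_prop, fun x y hxy => ?_, fun x hx => hδs ?_⟩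
  · exact e.injective (smul_right_injective _ (div_pos hδ hC).ne' (add_left_cancel hxy))
  · rw [mem_closedBall_iff_norm]
    change ‖c + (δ / C) • e x - c‖ ≤ δ
    rw [add_sub_cancel_left, norm_smul,
      Real.norm_of_nonneg (div_pos hδ hC).le, div_mul_eq_mul_div, div_le_iff₀ hC]
    refine mul_le_mul_of_nonneg_left ?_ hδ.le
    calc ‖e x‖ ≤ ‖e'‖ * ‖x‖ := e'.le_opNorm x
      _ ≤ ‖e'‖ * |r| := by gcongr; exact hx.trans (le_abs_self r)
      _ ≤ C := by simp [C]

theorem hasWidthMap_of_continuous {X : Type*} [TopologicalSpace X] {δ : X → X → ℝ} {ε r : ℝ}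
    (hε : 0 ≤ ε) (φ : X → W) (hφ : Continuous φ) (hr : ∀ x, ‖φ x‖ ≤ r)
    (hδ : ∀ x x', δ x x' = dist (φ x) (φ x')) : HasWidthMap X δ ε (Module.finrank ℝ W) := by
  obtain ⟨N, P, f, hP, hf, hinj, hfP⟩ := exists_continuous_injective_polyhedron W r
  refine ⟨N, P, f ∘ φ, hP, hf.comp hφ, fun x => hfP _ (hr x), fun x x' hx => ?_⟩
  rw [hδ, hinj hx, dist_self]
  exact hε

theorem HasWidthMap.comp {X Y : Type*} [TopologicalSpace X] [TopologicalSpace Y]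
    {δ : X → X → ℝ} {δ' : Y → Y → ℝ} {ε : ℝ} {k : ℕ} (h : HasWidthMap Y δ' ε k) {φ : X → Y}
    (hφ : Continuous φ) (hδ : ∀ x x', δ x x' = δ' (φ x) (φ x')) : HasWidthMap X δ ε k := by
  obtain ⟨N, P, f, hP, hf, hfP, hd⟩ := h
  exact ⟨N, P, f ∘ φ, hP, hf.comp hφ, fun x => hfP _, fun x x' hx =>
    (hδ x x').trans_le (hd _ _ hx)⟩

theorem wdim_le_of_continuous {X Y : Type*} [TopologicalSpace X] [TopologicalSpace Y]
    {δ : X → X → ℝ} {δ' : Y → Y → ℝ} (φ : X → Y)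
    (hφ : Continuous φ) (hδ : ∀ x x', δ x x' = δ' (φ x) (φ x')) (ε : ℝ) :
    wdim X δ ε ≤ wdim Y δ' ε :=
  le_iInf₂ fun k hk => iInf₂_le k (hk.comp hφ hδ)

theorem wdim_closedBall {ε : ℝ} (hε : 0 < ε) (hε1 : ε < 1) :
    wdim (Metric.closedBall (0 : W) 1) (fun x x' => dist x x') ε = Module.finrank ℝ W :=
  le_antisymm
    (iInf₂_le _ (hasWidthMap_of_continuous hε.le
      (fun x : Metric.closedBall (0 : W) 1 => (x : W)) continuous_subtype_val
      (fun x => mem_closedBall_zero_iff.1 x.2) fun _ _ => rfl))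
    (le_iInf₂ fun _ hk => Nat.cast_le.2 (finrank_le_of_hasWidthMap hε1 hk))

end Width

/-! ### Reduction from sequences on `Γ` to a finite set -/

section Restriction

variable {Γ V : Type*} [Group Γ] [NormedAddCommGroup V]

/-- The restriction of a map on `Γ` to the inverses of the elements of `Ω`. -/
def restr (p : ℝ≥0∞) (Ω : Finset Γ) (x : Γ → V) : PiLp p (fun _ : Ω => V) :=
  WithLp.toLp p fun γ => x (γ : Γ)⁻¹

/-- The extension by zero, a section of `restr`. -/
noncomputable def extend {p : ℝ≥0∞} {Ω : Finset Γ} (w : PiLp p (fun _ : Ω => V)) : Γ → V :=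
  open Classical in fun γ => if h : γ⁻¹ ∈ Ω then w ⟨γ⁻¹, h⟩ else 0

theorem restr_extend {p : ℝ≥0∞} {Ω : Finset Γ} (w : PiLp p (fun _ : Ω => V)) :
    restr p Ω (extend w) = w := by
  ext γ
  simp [restr, extend]

theorem continuous_restr (p : ℝ≥0∞) (Ω : Finset Γ) :
    Continuous (restr p Ω : (Γ → V) → PiLp p (fun _ : Ω => V)) :=
  (PiLp.continuous_toLp p _).comp (continuous_pi fun _ => continuous_apply _)

theorem continuous_extend {p : ℝ≥0∞} {Ω : Finset Γ} :
    Continuous (extend : PiLp p (fun _ : Ω => V) → Γ → V) := by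
  refine continuous_pi fun γ => ?_
  unfold extend
  split_ifs with h
  · exact PiLp.continuous_apply p _ _
  · exact continuous_const

variable (p : ℝ≥0∞) [hp : Fact (1 ≤ p)] (Ω : Finset Γ)

theorem evDist_eq_dist_restr (x x' : Γ → V) :
    evDist p Ω x x' = dist (restr p Ω x) (restr p Ω x') := by
  have hev : ∀ γ : Γ, (letI : MulAction Γ (Γ → V) := translation;
      ev (γ • x) (γ • x')) = dist (x γ⁻¹) (x' γ⁻¹) := fun γ => by
    rw [dist_eq_norm]
    change ‖x (γ⁻¹ * 1) - x' (γ⁻¹ * 1)‖ = _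
    rw [mul_one]
  unfold evDist orbitDist
  split_ifs with h
  · subst h
    rw [PiLp.dist_eq_iSup]
    simp only [hev]
    rfl
  · have h0 : 0 < p.toReal := ENNReal.toReal_pos (zero_lt_one.trans_le hp.out).ne' h
    rw [PiLp.dist_eq_sum h0, ← Finset.sum_coe_sort]
    simp only [hev]
    rfl

variable {p Ω}

theorem norm_restr_le {Y : Set (Γ → V)} {r : ℝ≥0} {x : Γ → V} (hx : x ∈ ballIn Y p r) :
    ‖restr p Ω x‖ ≤ r := by
  obtain ⟨-, g, hg, rfl⟩ := hx
  refine le_trans ?_ hg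
  rcases eq_or_ne p ∞ with rfl | h
  · rw [PiLp.norm_eq_ciSup]
    exact Real.iSup_le (fun γ => lp.norm_apply_le_norm ENNReal.top_ne_zero g _) (norm_nonneg _)
  · have h0 : 0 < p.toReal := ENNReal.toReal_pos (zero_lt_one.trans_le hp.out).ne' h
    rw [PiLp.norm_eq_sum h0, one_div, Real.rpow_inv_le_iff_of_pos
      (Finset.sum_nonneg fun _ _ => by positivity) (norm_nonneg _) h0]
    refine le_trans (le_of_eq ?_)
      (lp.sum_rpow_le_norm_rpow h0 g (Ω.map (Equiv.inv Γ).toEmbedding))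
    rw [Finset.sum_map, ← Finset.sum_coe_sort Ω]
    rfl

omit hp in
theorem memℓp_extend (w : PiLp p (fun _ : Ω => V)) (q : ℝ≥0∞) : Memℓp (extend w) q := by
  refine Memℓp.of_exponent_ge (memℓp_zero ?_) zero_le
  refine (Ω.map (Equiv.inv Γ).toEmbedding).finite_toSet.subset fun γ hγ => ?_
  by_contra h
  refine hγ (dif_neg fun h' => h ?_)
  exact Finset.mem_coe.2 (Finset.mem_map.2 ⟨γ⁻¹, h', by simp⟩)

theorem extend_mem_ballIn {w : PiLp p (fun _ : Ω => V)} {r : ℝ≥0} (hw : ‖w‖ ≤ r) (q : ℝ≥0∞) :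
    extend w ∈ ballIn (ell Γ V q) p r := by
  refine ⟨memℓp_extend w q, ⟨extend w, memℓp_extend w p⟩, le_trans ?_ hw, rfl⟩
  rcases eq_or_ne p ∞ with rfl | h
  · refine lp.norm_le_of_forall_le (norm_nonneg _) fun γ => ?_
    change ‖extend w γ‖ ≤ _
    unfold extend
    split_ifs with h
    · exact PiLp.norm_apply_le w _
    · simp
  · have h0 : 0 < p.toReal := ENNReal.toReal_pos (zero_lt_one.trans_le hp.out).ne' h
    refine lp.norm_le_of_tsum_le h0 (norm_nonneg _) (le_of_eq ?_)
    change ∑' γ, ‖extend w γ‖ ^ p.toReal = _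
    rw [tsum_eq_sum (s := Ω.map (Equiv.inv Γ).toEmbedding), Finset.sum_map,
      PiLp.norm_eq_sum h0, one_div, Real.rpow_inv_rpow
      (Finset.sum_nonneg fun _ _ => by positivity) h0.ne', ← Finset.sum_coe_sort]
    · refine Finset.sum_congr rfl fun γ _ => ?_
      simp [extend]
    · intro γ hγ
      have : γ⁻¹ ∉ Ω := fun h' => hγ (Finset.mem_map.2 ⟨γ⁻¹, h', by simp⟩)
      simp [extend, this, h0.ne']

/-- Widths pull back along continuous distance-preserving maps, and such maps exist both ways. The
extension has finite support, so it lies in every `ℓ^q`; this is why `q` plays no role. -/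
theorem wdim_ballIn_eq (q : ℝ≥0∞) (ε : ℝ) :
    wdim (ballIn (ell Γ V q) p 1) (fun x x' => evDist p Ω (x : Γ → V) (x' : Γ → V)) ε =
      wdim (Metric.closedBall (0 : PiLp p (fun _ : Ω => V)) 1) (fun x x' => dist x x') ε := by
  refine le_antisymm
    (wdim_le_of_continuous
      (fun x : ballIn (ell Γ V q) p 1 => ⟨restr p Ω (x : Γ → V),
        mem_closedBall_zero_iff.2 (norm_restr_le x.2)⟩)
      (((continuous_restr p Ω).comp continuous_subtype_val).subtype_mk _)
      (fun x x' => evDist_eq_dist_restr p Ω (x : Γ → V) (x' : Γ → V)) ε)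
    (wdim_le_of_continuous
      (fun w : Metric.closedBall (0 : PiLp p (fun _ : Ω => V)) 1 => ⟨extend w.1,
        extend_mem_ballIn (mem_closedBall_zero_iff.1 w.2) q⟩)
      ((continuous_extend.comp continuous_subtype_val).subtype_mk _) (fun w w' => ?_) ε)
  rw [evDist_eq_dist_restr, restr_extend, restr_extend]
  rfl

variable [NormedSpace ℝ V] [FiniteDimensional ℝ V]

omit [Group Γ] hp in
theorem finrank_piLp :
    Module.finrank ℝ (PiLp p (fun _ : Ω => V)) = Ω.card * Module.finrank ℝ V := by
  rw [(WithLp.linearEquiv p ℝ (Ω → V)).finrank_eq, Module.finrank_pi_fintype]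
  simp

theorem wdim_ballIn_le (Y : Set (Γ → V)) (r : ℝ≥0) {ε : ℝ} (hε : 0 < ε) :
    wdim (ballIn Y p r) (fun x x' => evDist p Ω (x : Γ → V) (x' : Γ → V)) ε ≤
      (Ω.card * Module.finrank ℝ V : ℕ) := by
  rw [← finrank_piLp (p := p)]
  exact iInf₂_le _ (hasWidthMap_of_continuous hε.le
    (fun x : ballIn Y p r => restr p Ω (x : Γ → V))
    ((continuous_restr p Ω).comp continuous_subtype_val) (fun x => norm_restr_le x.2)
    fun x x' => evDist_eq_dist_restr p Ω (x : Γ → V) (x' : Γ → V))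

omit [Group Γ] in
theorem wdim_closedBall_piLp {ε : ℝ} (hε : 0 < ε) (hε1 : ε < 1) :
    wdim (Metric.closedBall (0 : PiLp p (fun _ : Ω => V)) 1) (fun x x' => dist x x') ε =
      (Ω.card * Module.finrank ℝ V : ℕ) := by
  rw [← finrank_piLp (p := p)]
  exact wdim_closedBall hε hε1

end Restriction

/-! ### The von Neumann dimension -/

section Dimension

variable {Γ V : Type*} [Group Γ] [NormedAddCommGroup V] [NormedSpace ℝ V] [FiniteDimensional ℝ V]

/-- The only consequence of the Følner condition that is needed: it permits division by `|Ω_i|`. -/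
theorem IsFolnerSeq.eventually_nonempty {Ω : ℕ → Finset Γ} (hΩ : IsFolnerSeq Ω) :
    ∀ᶠ i in atTop, (Ω i).Nonempty := by
  let _ : MeasurableSpace Γ := ⊤
  have : ∀ᶠ i in atTop, (Measure.count : Measure Γ) (Ω i : Set Γ) ≠ 0 :=
    hΩ.elim (fun h => h.eventually_meas_ne_zero) fun h => h.eventually_meas_ne_zero
  filter_upwards [this] with i hi
  by_contra h
  rw [Finset.not_nonempty_iff_eq_empty] at h
  simp [h] at hi

variable (p : ℝ≥0∞) [Fact (1 ≤ p)] (Y : Set (Γ → V)) (Ω : ℕ → Finset Γ)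

theorem wgc_ballIn_le (r : ℝ≥0) :
    (letI : MulAction Γ (Γ → V) := translation;
      wgc (ballIn Y p r) ev p Ω) ≤ Module.finrank ℝ V := by
  let _ : MulAction Γ (Γ → V) := translation
  refine le_of_tendsto (tendsto_wgc (ballIn Y p r) ev p Ω) ?_
  filter_upwards [self_mem_nhdsWithin] with ε hε
  refine limsup_le_of_le (h := Eventually.of_forall fun i => ?_)
  -- This covers empty `Ω i` too, since `0 / 0 = 0` in `ℝ≥0∞`.
  refine ENNReal.div_le_of_le_mul' ?_
  have := ENat.toENNReal_le.2 (wdim_ballIn_le (p := p) (Ω := Ω i) Y r hε)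
  rw [ENat.toENNReal_coe, Nat.cast_mul] at this
  exact this

variable {Ω}

theorem wgc_ballIn_one (hΩ : IsFolnerSeq Ω) (q : ℝ≥0∞) :
    (letI : MulAction Γ (Γ → V) := translation;
      wgc (ballIn (ell Γ V q) p 1) ev p Ω) = Module.finrank ℝ V := by
  let _ : MulAction Γ (Γ → V) := translation
  refine tendsto_nhds_unique (tendsto_wgc (ballIn (ell Γ V q) p 1) ev p Ω) ?_
  refine tendsto_const_nhds.congr' ?_
  filter_upwards [Ioo_mem_nhdsGT one_pos] with ε hε
  refine ((limsup_congr ?_).trans (limsup_const _)).symm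
  filter_upwards [hΩ.eventually_nonempty] with i hi
  have h : wdim (ballIn (ell Γ V q) p 1)
      (fun x x' => orbitDist ev p (Ω i) (x : Γ → V) (x' : Γ → V)) ε =
      ((Ω i).card * Module.finrank ℝ V : ℕ) :=
    (wdim_ballIn_eq q ε).trans (wdim_closedBall_piLp hε.1 hε.2)
  rw [h, ENat.toENNReal_coe, Nat.cast_mul, mul_comm]
  exact ENNReal.mul_div_cancel_right (by simpa using hi.ne_empty) (ENNReal.natCast_ne_top _)

end Dimension

end LpDim
theorem mainTheorem4 {Γ : Type*} [Group Γ] [Countable Γ]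
    {V : Type*} [NormedAddCommGroup V] [NormedSpace ℝ V] [FiniteDimensional ℝ V]
    (p q : ℝ≥0∞) [Fact (1 ≤ p)] (hq : 1 ≤ q) :
    (∀ (Ω : Finset Γ) (ε : ℝ), 0 < ε →
      LpDim.wdim (LpDim.ballIn (LpDim.ell Γ V q) p 1)
          (fun x x' => LpDim.evDist p Ω (x : Γ → V) (x' : Γ → V)) ε =
        LpDim.wdim (Metric.closedBall (0 : PiLp p (fun _ : Ω => V)) 1)
          (fun x x' => dist x x') ε ∧
      (ε < 1 →
        LpDim.wdim (Metric.closedBall (0 : PiLp p (fun _ : Ω => V)) 1)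
          (fun x x' => dist x x') ε = ((Ω.card * Module.finrank ℝ V : ℕ) : ℕ∞))) ∧
    (∀ Ω : ℕ → Finset Γ, LpDim.IsFolnerSeq Ω →
      LpDim.dimLp p (LpDim.ell Γ V q) Ω = (Module.finrank ℝ V : ℝ≥0∞)) := by
  refine ⟨fun Ω ε hε => ⟨LpDim.wdim_ballIn_eq q ε, fun hε1 => LpDim.wdim_closedBall_piLp hε hε1⟩,
    fun Ω hΩ => le_antisymm (iSup_le fun r => LpDim.wgc_ballIn_le p _ Ω r) ?_⟩
  -- Radius `1` already attains the supremum.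
  exact (LpDim.wgc_ballIn_one p hΩ q).ge.trans (le_iSup_of_le 1 le_rfl)
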